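/- Let $p:\mathbb R\to\mathbb R$ be such that $p,p'\in AC_{loc}(\mathbb R)$ and $p(x)>0$ for all $x$. Let $\mu_p(I)=\int_I p^{-1/2}$, $\zeta(x)=\int_0^x p^{-1/2}(u)\,du$, and let the potential $q$ be given by $q(\zeta(x))=\frac14 p''(x)-\frac1{16}\frac{p'(x)^2}{p(x)}$. On $L^2(\mathbb R)$ (complex valued), let $A_p$ and $B_q$ be the maximal operators of the expressions $-(pf')'$ and $-f''+qf$, where the maximal operator of $\tau f=-(pf')'+qf$ has domain $\{f\in L^2(\mathbb R): f,\,pf'\in AC_{loc},\ \tau f\in L^2(\mathbb R)\}$. For a Borel set $\Lambda\subseteq\mathbb R$ (in particular, for one of finite measure) and an operator $A$ with spectral measure $E$, put $PW_\Lambda(A)=\{f\in L^2(\mathbb R): E(\Lambda)f=f\}$. Let the Liouville transform be $U_Lf=(p^{1/4}f)\circ\zeta^{-1}$. For $X\subseteq\mathbb R$ put $$D_p^+(X)=\limsup_{r\to\infty}\sup_{\mu_p(I)=r}\frac{\#(X\cap I)}r,\qquad D_p^-(X)=\liminf_{r\to\infty}\inf_{\mu_p(I)=r}\frac{\#(X\cap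 I)}r\qquad(I\text{ a compact interval}),$$ with values in $[0,\infty]$, and let $D^\pm$ be the same quantities for $p\equiv1$, i.e. for Lebesgue measure. A reproducing kernel of a space $V\subseteq L^2(\mathbb R)$ is a family $k(x,\cdot)\in V$, $x\in\mathbb R$, such that for every $f\in V$ the function $x\mapsto\langle f,k(x,\cdot)\rangle$ is a continuous representative of $f$. Assume first that $\int_0^\infty p^{-1/2}=\int_{-\infty}^0p^{-1/2}=\infty$, i.e. that $\zeta$ maps $\mathbb R$ onto $\mathbb R$. Then: 1. $U_L\big(PW_\Lambda(A_p)\big)=PW_\Lambda(B_q)$. 2. $D_p^{\pm}(X)=D^{\pm}(\zeta(X))$ for every $X\subseteq\mathbb R$. 3. If $k$ is the reproducing kernel of $PW_\Lambda(A_p)$ and $h$ is the reproducing kernel of $PW_\Lambda(B_q)$, then $h(\zeta(x),\cdot)=p^{1/4}(x)\,U_Lk(x,\cdot)$ for all $x\in\mathbb R$. 4. If $0<c\le p(x)\le C$ for all $x\in\mathbb R$ (so that $\zeta$ is automatically onto), and $k,h$ are the reproducing kernels as in 3, then for every $X\subseteq\mathbb R$ the family $(k(x,\cdot))_{x\in X}$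 is a frame for $PW_\Lambda(A_p)$ if and only if $(h(\zeta(x),\cdot))_{x\in X}$ is a frame for $PW_\Lambda(B_q)$; and $(k(x,\cdot))_{x\in X}$ is a Riesz sequence for $PW_\Lambda(A_p)$ if and only if $(h(\zeta(x),\cdot))_{x\in X}$ is a Riesz sequence for $PW_\Lambda(B_q)$. -/

import Mathlib

open MeasureTheory Set Filter Topology
open scoped ENNReal

noncomputable section

namespace VariableBandwidth

/-! ### Locally absolutely continuous functions -/

/-- The class `AC_loc(ℝ)`: absolute continuity on every compact interval. -/
def LocAC {F : Type*} [NormedAddCommGroup F] (u : ℝ → F) : Prop :=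
  ∀ a b : ℝ, AbsolutelyContinuousOnInterval u a b

theorem LocAC.continuous {F : Type*} [NormedAddCommGroup F] {u : ℝ → F} (hu : LocAC u) :
    Continuous u := by
  rw [continuous_iff_continuousAt]
  intro x
  refine (hu (x - 1) (x + 1)).continuousOn.continuousAt ?_
  rw [uIcc_of_le (by linarith)]
  exact Icc_mem_nhds (by linarith) (by linarith)

theorem LocAC.ae_differentiableAt {u : ℝ → ℂ} (hu : LocAC u) :
    ∀ᵐ x, DifferentiableAt ℝ u x := by
  apply LocallyBoundedVariationOn.ae_differentiableAt
  intro a b _ _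
  rcases le_total a b with h | h
  · have := (hu a b).boundedVariationOn
    rw [uIcc_of_le h] at this
    simpa using this
  · have hs : (univ ∩ Icc a b : Set ℝ).Subsingleton := by
      rintro x ⟨_, hx1, hx2⟩ y ⟨_, hy1, hy2⟩
      linarith
    rw [BoundedVariationOn, eVariationOn.subsingleton u hs]
    exact ENNReal.zero_ne_top

/-! ### The Hilbert space and the maximal Sturm-Liouville operators -/

/-- The complex Hilbert space `L²(ℝ)`. -/
abbrev L2 : Type := Lp ℂ 2 (volume : Measure ℝ)

/-- The graph of the maximal operator of `τ f = -(p f')' + q f`: the pairs `(f, g)` in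
`L² × L²` such that `f` has a representative `u ∈ AC_loc`, the function `p u'` has a
representative `v ∈ AC_loc`, and `g = -v' + q u` almost everywhere. -/
def slGraph (p q : ℝ → ℝ) : Submodule ℂ (L2 × L2) where
  carrier := {fg | ∃ u v : ℝ → ℂ, LocAC u ∧ LocAC v ∧ (fg.1 : ℝ → ℂ) =ᵐ[volume] u ∧
    (∀ᵐ x, v x = (p x : ℂ) * deriv u x) ∧
    (∀ᵐ x, (fg.2 : ℝ → ℂ) x = -deriv v x + (q x : ℂ) * u x)}
  zero_mem' := by
    refine ⟨0, 0, ?_, ?_, Lp.coeFn_zero _ _ _, ?_, ?_⟩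
    · intro a b
      exact (LipschitzWith.const (0 : ℂ)).lipschitzOnWith.absolutelyContinuousOnInterval
    · intro a b
      exact (LipschitzWith.const (0 : ℂ)).lipschitzOnWith.absolutelyContinuousOnInterval
    · simp
    · simp
  add_mem' := by
    rintro ⟨f₁, g₁⟩ ⟨f₂, g₂⟩ ⟨u₁, v₁, hu₁, hv₁, hf₁, hp₁, hg₁⟩ ⟨u₂, v₂, hu₂, hv₂, hf₂, hp₂, hg₂⟩
    refine ⟨u₁ + u₂, v₁ + v₂, fun a b => (hu₁ a b).add (hu₂ a b),
      fun a b => (hv₁ a b).add (hv₂ a b), (Lp.coeFn_add f₁ f₂).trans (hf₁.add hf₂), ?_, ?_⟩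
    · filter_upwards [hp₁, hp₂, hu₁.ae_differentiableAt, hu₂.ae_differentiableAt]
        with x h₁ h₂ d₁ d₂
      rw [Pi.add_apply, h₁, h₂, deriv_add d₁ d₂]
      ring
    · filter_upwards [hg₁, hg₂, hv₁.ae_differentiableAt, hv₂.ae_differentiableAt,
        Lp.coeFn_add g₁ g₂] with x h₁ h₂ d₁ d₂ h
      change (g₁ + g₂ : L2) x = _
      rw [h, Pi.add_apply, h₁, h₂, deriv_add d₁ d₂, Pi.add_apply]
      ring
  smul_mem' := by
    rintro c ⟨f, g⟩ ⟨u, v, hu, hv, hf, hp, hg⟩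
    refine ⟨c • u, c • v, fun a b => (hu a b).const_smul c, fun a b => (hv a b).const_smul c,
      (Lp.coeFn_smul c f).trans (hf.const_smul c), ?_, ?_⟩
    · filter_upwards [hp, hu.ae_differentiableAt] with x h d
      rw [Pi.smul_apply, h, deriv_const_smul c d, smul_eq_mul, smul_eq_mul]
      ring
    · filter_upwards [hg, hv.ae_differentiableAt, Lp.coeFn_smul c g] with x h d hc
      change (c • g : L2) x = _
      rw [hc, Pi.smul_apply, h, deriv_const_smul c d, Pi.smul_apply, smul_eq_mul, smul_eq_mul,
        smul_eq_mul]
      ring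

theorem slGraph_functional (p q : ℝ → ℝ) (fg : L2 × L2) (h : fg ∈ slGraph p q)
    (h0 : fg.1 = 0) : fg.2 = 0 := by
  obtain ⟨u, v, hu, hv, hf, hp, hg⟩ := h
  have hu0 : u = 0 := by
    refine Measure.eq_of_ae_eq (μ := volume) ?_ hu.continuous continuous_const
    rw [h0] at hf
    exact hf.symm.trans (Lp.coeFn_zero _ _ _)
  subst hu0
  have hv0 : v = 0 := by
    refine Measure.eq_of_ae_eq (μ := volume) ?_ hv.continuous continuous_const
    filter_upwards [hp] with x hx
    simp [hx]
  subst hv0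
  refine Lp.ext ?_
  filter_upwards [hg, Lp.coeFn_zero ℂ 2 (volume : Measure ℝ)] with x hx h
  rw [hx, h]
  simp

/-- The maximal operator `A` of `τ f = -(p f')' + q f` in `L²(ℝ)`, with domain
`{f ∈ L² : f, p f' ∈ AC_loc, τ f ∈ L²}`. -/
def slOperator (p q : ℝ → ℝ) : L2 →ₗ.[ℂ] L2 := (slGraph p q).toLinearPMap

theorem slOperator_graph (p q : ℝ → ℝ) : (slOperator p q).graph = slGraph p q :=
  Submodule.toLinearPMap_graph_eq _ (slGraph_functional p q)

/-- `A_p f = -(p f')'`. -/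
def opA (p : ℝ → ℝ) : L2 →ₗ.[ℂ] L2 := slOperator p (fun _ => 0)

/-- `B_q f = -f'' + q f`. -/
def opB (q : ℝ → ℝ) : L2 →ₗ.[ℂ] L2 := slOperator (fun _ => 1) q

/-! ### Spectral measures and Paley-Wiener spaces -/

/-- A projection-valued Borel measure on `ℝ`: orthogonal projections, total mass `1`, countably
additive in the strong operator topology. (Values on non-Borel sets are irrelevant.) -/
structure ProjMeasure (H : Type*) [NormedAddCommGroup H] [InnerProductSpace ℂ H]
    [CompleteSpace H] where
  proj : Set ℝ → H →L[ℂ] H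
  isStarProjection : ∀ s, MeasurableSet s → IsStarProjection (proj s)
  proj_univ : proj univ = 1
  hasSum_iUnion : ∀ s : ℕ → Set ℝ, (∀ i, MeasurableSet (s i)) →
    Pairwise (Function.onFun Disjoint s) →
    ∀ f : H, HasSum (fun i => proj (s i) f) (proj (⋃ i, s i) f)

namespace ProjMeasure

variable {H : Type*} [NormedAddCommGroup H] [InnerProductSpace ℂ H] [CompleteSpace H]

theorem norm_sq_proj (E : ProjMeasure H) {s : Set ℝ} (hs : MeasurableSet s) (f : H) :
    ‖E.proj s f‖ ^ 2 = (inner ℂ f (E.proj s f)).re := by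
  have hE := E.isStarProjection s hs
  have h1 : E.proj s (E.proj s f) = E.proj s f :=
    DFunLike.congr_fun hE.isIdempotentElem f
  have h2 : inner ℂ (E.proj s f) (E.proj s f) = inner ℂ f (E.proj s f) := by
    have := ContinuousLinearMap.adjoint_inner_right (E.proj s) f (E.proj s f)
    rw [← ContinuousLinearMap.star_eq_adjoint, hE.isSelfAdjoint.star_eq, h1] at this
    exact this.symm
  rw [← h2, inner_self_eq_norm_sq_to_K]
  norm_cast

theorem proj_empty (E : ProjMeasure H) (f : H) : E.proj ∅ f = 0 := by
  have h := E.hasSum_iUnion (fun _ => ∅) (fun _ => MeasurableSet.empty)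
    (fun i j _ => by simp [Function.onFun]) f
  exact tendsto_nhds_unique tendsto_const_nhds h.summable.tendsto_atTop_zero

/-- The scalar spectral measure `s ↦ ‖E(s) f‖² = ⟨E(s) f, f⟩`. -/
def scalarMeasure (E : ProjMeasure H) (f : H) : Measure ℝ :=
  Measure.ofMeasurable (fun s _ => ENNReal.ofReal (‖E.proj s f‖ ^ 2))
    (by simp [E.proj_empty f])
    (by
      intro s hs hd
      have h := (E.hasSum_iUnion s hs hd f).mapL (innerSL ℂ f)
      have h' := Complex.hasSum_re h
      simp only [innerSL_apply_apply] at h'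
      simp only [← E.norm_sq_proj (hs _), ← E.norm_sq_proj (MeasurableSet.iUnion hs)] at h'
      rw [← h'.tsum_eq]
      exact ENNReal.ofReal_tsum_of_nonneg (fun i => by positivity) h'.summable)

/-- `E` is the spectral measure of the (unbounded) operator `A`, i.e. `A = ∫ t dE(t)` with domain
`{f : ∫ t² d‖E(t) f‖² < ∞}`. (By polarization, the quadratic form on the dense domain
determines `A`.) -/
def IsSpectralMeasure (E : ProjMeasure H) (A : H →ₗ.[ℂ] H) : Prop :=
  (∀ f : H, f ∈ A.domain ↔ ∫⁻ t, ENNReal.ofReal (t ^ 2) ∂(E.scalarMeasure f) < ∞) ∧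
  ∀ f : A.domain, inner ℂ (f : H) (A f) = ((∫ t, t ∂(E.scalarMeasure (f : H)) : ℝ) : ℂ)

end ProjMeasure

/-- The Paley-Wiener space `PW_Λ(A) = {f : c_Λ(A) f = f}`, where the spectral projection
`c_Λ(A)` is the value at `Λ` of the spectral measure of `A` (which, for self-adjoint `A`, exists
and is unique on Borel sets). -/
def PW {H : Type*} [NormedAddCommGroup H] [InnerProductSpace ℂ H] [CompleteSpace H]
    (Λ : Set ℝ) (A : H →ₗ.[ℂ] H) : Set H :=
  {f | ∃ E : ProjMeasure H, E.IsSpectralMeasure A ∧ E.proj Λ f = f}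

/-- `k : x ↦ k(x, ·)` is the reproducing kernel of the space `V` of `L²` functions, whose elements
are identified with their continuous representatives: every `k(x, ·)` is in `V`, and
every `f ∈ V` has the continuous representative `x ↦ ⟨f, k(x, ·)⟩`. -/
def IsReproducingKernel (V : Set L2) (k : ℝ → L2) : Prop :=
  (∀ x, k x ∈ V) ∧ ∀ f ∈ V, Continuous (fun x => inner ℂ (k x) f) ∧
    (f : ℝ → ℂ) =ᵐ[volume] fun x => inner ℂ (k x) f

/-! ### Frames and Riesz sequences -/

/-- The family `v` is a frame for `V`. -/
def IsFrame {H : Type*} [NormedAddCommGroup H] [InnerProductSpace ℂ H] (V : Set H)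
    {ι : Type*} (v : ι → H) : Prop :=
  (∀ i, v i ∈ V) ∧ ∃ a b : ℝ, 0 < a ∧ 0 < b ∧ ∀ f ∈ V,
    ENNReal.ofReal (a * ‖f‖ ^ 2) ≤ ∑' i, ENNReal.ofReal (‖inner ℂ (v i) f‖ ^ 2) ∧
    ∑' i, ENNReal.ofReal (‖inner ℂ (v i) f‖ ^ 2) ≤ ENNReal.ofReal (b * ‖f‖ ^ 2)

/-- The family `v` is a Riesz sequence for `V`; part of the definition is that `∑ c_i v_i`
converges for all `c ∈ ℓ²`. -/
def IsRieszSequence {H : Type*} [NormedAddCommGroup H] [InnerProductSpace ℂ H] (V : Set H)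
    {ι : Type*} (v : ι → H) : Prop :=
  (∀ i, v i ∈ V) ∧ ∃ a b : ℝ, 0 < a ∧ 0 < b ∧ ∀ c : ι → ℂ, Summable (fun i => ‖c i‖ ^ 2) →
    Summable (fun i => c i • v i) ∧
    a * ∑' i, ‖c i‖ ^ 2 ≤ ‖∑' i, c i • v i‖ ^ 2 ∧
    ‖∑' i, c i • v i‖ ^ 2 ≤ b * ∑' i, ‖c i‖ ^ 2

/-! ### Beurling densities -/

/-- Upper Beurling density of `X` with respect to `μ`:
`limsup_{r → ∞} sup_{μ(I) = r} #(X ∩ I) / r`, with `I` a compact interval. -/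
def upperDensity (μ : Measure ℝ) (X : Set ℝ) : ℝ≥0∞ :=
  limsup (fun r : ℝ => ⨆ (a : ℝ) (b : ℝ) (_ : μ (Icc a b) = ENNReal.ofReal r),
    ((X ∩ Icc a b).encard : ℝ≥0∞) / ENNReal.ofReal r) atTop

/-- Lower Beurling density of `X` with respect to `μ`:
`liminf_{r → ∞} inf_{μ(I) = r} #(X ∩ I) / r`, with `I` a compact interval. -/
def lowerDensity (μ : Measure ℝ) (X : Set ℝ) : ℝ≥0∞ :=
  liminf (fun r : ℝ => ⨅ (a : ℝ) (b : ℝ) (_ : μ (Icc a b) = ENNReal.ofReal r),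
    ((X ∩ Icc a b).encard : ℝ≥0∞) / ENNReal.ofReal r) atTop

/-- `μ_p(I) = ∫_I p^{-1/2}`. -/
def muP (p : ℝ → ℝ) : Measure ℝ :=
  volume.withDensity fun u => ENNReal.ofReal (p u ^ (-(1 / 2) : ℝ))

/-! ### The Liouville transform -/

/-- `ζ(x) = ∫₀ˣ p^{-1/2}`. -/
def zeta (p : ℝ → ℝ) (x : ℝ) : ℝ := ∫ u in (0 : ℝ)..x, p u ^ (-(1 / 2) : ℝ)

/-- The inverse of `ζ` (used where `ζ` is a bijection of `ℝ`). -/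
def zetaInv (p : ℝ → ℝ) : ℝ → ℝ := Function.invFun (zeta p)

/-- `(p^{1/4} f) ∘ ζ⁻¹` as a function. -/
def liouvilleFun (p : ℝ → ℝ) (f : ℝ → ℂ) (y : ℝ) : ℂ :=
  ((p (zetaInv p y) ^ (1 / 4 : ℝ) : ℝ) : ℂ) * f (zetaInv p y)

open Classical in
/-- The Liouville transform `U_L f = (p^{1/4} f) ∘ ζ⁻¹` on `L²(ℝ)`. The `else` branch does not
occur if `p` is continuous and positive and `ζ` is onto, see `memLp_liouvilleFun`. -/
def liouville (p : ℝ → ℝ) (f : L2) : L2 :=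
  if h : MemLp (liouvilleFun p f) 2 volume then h.toLp (liouvilleFun p f) else 0

/-- The potential `q` with `q(ζ(x)) = p''(x) / 4 - p'(x)² / (16 p(x))`. -/
def potential (p : ℝ → ℝ) (y : ℝ) : ℝ :=
  deriv (deriv p) (zetaInv p y) / 4 - deriv p (zetaInv p y) ^ 2 / (16 * p (zetaInv p y))

section WellDefined

variable {p : ℝ → ℝ}

theorem hasDerivAt_zeta (hp : Continuous p) (hpos : ∀ x, 0 < p x) (x : ℝ) :
    HasDerivAt (zeta p) (p x ^ (-(1 / 2) : ℝ)) x := by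
  have hc : Continuous fun u => p u ^ (-(1 / 2) : ℝ) :=
    hp.rpow_const fun x => Or.inl (hpos x).ne'
  exact intervalIntegral.integral_hasDerivAt_right (hc.intervalIntegrable _ _)
    hc.aestronglyMeasurable.stronglyMeasurableAtFilter hc.continuousAt

theorem strictMono_zeta (hp : Continuous p) (hpos : ∀ x, 0 < p x) : StrictMono (zeta p) :=
  strictMono_of_hasDerivAt_pos (hasDerivAt_zeta hp hpos) fun x => Real.rpow_pos_of_pos (hpos x) _

theorem memLp_liouvilleFun (hp : Continuous p) (hpos : ∀ x, 0 < p x)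
    (hζ : Function.Surjective (zeta p)) (f : L2) : MemLp (liouvilleFun p f) 2 volume := by
  have hmono := strictMono_zeta hp hpos
  have hl : ∀ x, zetaInv p (zeta p x) = x := Function.leftInverse_invFun hmono.injective
  have hr : ∀ y, zeta p (zetaInv p y) = y := Function.rightInverse_invFun hζ
  have hinv : Measurable (zetaInv p) := by
    refine Monotone.measurable fun a b hab => ?_
    rw [← hmono.le_iff_le, hr, hr]
    exact hab
  have hsm : Measurable (liouvilleFun p f) := by
    have h1 : Measurable fun x => ((p x ^ (1 / 4 : ℝ) : ℝ) : ℂ) :=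
      Complex.measurable_ofReal.comp (hp.measurable.pow_const _)
    exact (h1.comp hinv).mul ((Lp.stronglyMeasurable f).measurable.comp hinv)
  refine ⟨hsm.aestronglyMeasurable, ?_⟩
  have hf := (Lp.memLp f).2
  rw [eLpNorm_lt_top_iff_lintegral_rpow_enorm_lt_top two_ne_zero ENNReal.ofNat_ne_top] at hf ⊢
  refine lt_of_eq_of_lt ?_ hf
  have hcv := lintegral_image_eq_lintegral_abs_deriv_mul (s := univ) MeasurableSet.univ
    (fun x _ => (hasDerivAt_zeta hp hpos x).hasDerivWithinAt) hmono.injective.injOn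
    (fun y => ‖liouvilleFun p f y‖ₑ ^ (2 : ℝ≥0∞).toReal)
  rw [image_univ, hζ.range_eq, Measure.restrict_univ] at hcv
  rw [hcv]
  refine lintegral_congr fun x => ?_
  have hx := hpos x
  have e : |p x ^ (-(1 / 2) : ℝ)| * (p x ^ (1 / 4 : ℝ)) ^ 2 = 1 := by
    rw [abs_of_pos (Real.rpow_pos_of_pos hx _), ← Real.rpow_natCast, ← Real.rpow_mul hx.le,
      ← Real.rpow_add hx]
    norm_num
  have e' : ‖((p x ^ (1 / 4 : ℝ) : ℝ) : ℂ)‖ₑ = ENNReal.ofReal (p x ^ (1 / 4 : ℝ)) := by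
    rw [← ofReal_norm, Complex.norm_real, Real.norm_of_nonneg (by positivity)]
  simp only [liouvilleFun, hl, enorm_mul, e', ENNReal.toReal_ofNat, ENNReal.rpow_ofNat]
  rw [mul_pow, ← mul_assoc, ← ENNReal.ofReal_pow (by positivity),
    ← ENNReal.ofReal_mul (abs_nonneg _), e, ENNReal.ofReal_one, one_mul]

end WellDefined

end VariableBandwidth

end

open VariableBandwidth

open MeasureTheory Set Filter Topology
open scoped ENNReal

noncomputable section

namespace VariableBandwidth

/-! ### Locally absolutely continuous functions -/

namespace LocAC

/-! The substitution y = ζ(x) has Jacobian p^{-1/2}, which the square of the weight p^{1/4} cancels,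
so the Liouville transform U is unitary (`liouvilleEquiv`). The chain rule shows that it carries the
graph of -(pf')' exactly onto the graph of -f'' + qf (`liouville_mem_slGraph`,
`mem_slGraph_of_liouville`): the first-order terms cancel and the remaining zeroth-order term is q.
Conjugating by U therefore turns a spectral measure of one operator into one of the other, and the
Paley-Wiener spaces correspond (`image_PW`).

The densities agree because ζ maps intervals bijectively to intervals and μ_p to Lebesgue measure.
For the kernels, p^{1/4} U k(x,·), taken at y = ζ(x), reproduces U(PW), and a reproducing kernel is
unique. If c ≤ p ≤ C, the two kernel families differ by a unitary and by scalars bounded above and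
away from 0, which preserves frames and Riesz sequences (`IsFrame.map`, `IsRieszSequence.map`). -/

theorem add {F : Type*} [NormedAddCommGroup F] {u v : ℝ → F} (hu : LocAC u) (hv : LocAC v) :
    LocAC fun x => u x + v x :=
  fun a b => (hu a b).add (hv a b)

theorem ofReal_mul {r : ℝ → ℝ} {u : ℝ → ℂ} (hr : LocAC r) (hu : LocAC u) :
    LocAC fun x => (r x : ℂ) * u x := fun a b => by
  have h := (hr a b).smul (hu a b)
  have e : (r • u) = fun x => (r x : ℂ) * u x := by
    funext x
    simp [Complex.real_smul]
  rwa [e] at h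

theorem of_contDiff {F : Type*} [NormedAddCommGroup F] [NormedSpace ℝ F] {u : ℝ → F}
    (hu : ContDiff ℝ 1 u) : LocAC u :=
  fun _ _ => hu.contDiffOn.absolutelyContinuousOnInterval

theorem ae_differentiableAt_real {u : ℝ → ℝ} (hu : LocAC u) :
    ∀ᵐ x, DifferentiableAt ℝ u x := by
  have h : LocAC fun x => (u x : ℂ) := by
    have := hu.ofReal_mul (of_contDiff (u := fun _ => (1 : ℂ)) contDiff_const)
    simpa using this
  filter_upwards [h.ae_differentiableAt] with x hx
  have := Complex.reCLM.differentiableAt.comp x hx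
  exact this

/-- A monotone ψ sends disjoint intervals to disjoint intervals, and its absolute continuity makes
their total length small; the two ε-δ conditions then compose. Without monotonicity the images could
overlap. -/
theorem comp_monotone {F : Type*} [NormedAddCommGroup F] {u : ℝ → F} {ψ : ℝ → ℝ}
    (hu : LocAC u) (hψ : LocAC ψ) (hm : Monotone ψ) : LocAC fun x => u (ψ x) := by
  intro a b
  have hu' := hu (ψ a) (ψ b)
  have hψ' := hψ a b
  rw [absolutelyContinuousOnInterval_iff] at hu' hψ' ⊢
  intro ε hε
  obtain ⟨δ, hδ, h⟩ := hu' ε hε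
  obtain ⟨η, hη, h'⟩ := hψ' δ hδ
  refine ⟨η, hη, fun E hE hlen => ?_⟩
  refine h (E.1, fun i => (ψ (E.2 i).1, ψ (E.2 i).2)) ⟨fun i hi => ?_, fun i hi j hj hij => ?_⟩
    (h' E hE hlen)
  · obtain ⟨h1, h2⟩ := hE.1 i hi
    simp only [mem_uIcc] at h1 h2 ⊢
    exact ⟨h1.imp (fun h => ⟨hm h.1, hm h.2⟩) (fun h => ⟨hm h.1, hm h.2⟩),
      h2.imp (fun h => ⟨hm h.1, hm h.2⟩) (fun h => ⟨hm h.1, hm h.2⟩)⟩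
  · have hd := hE.2 hi hj hij
    -- Disjointness of half-open intervals is an inequality between a min and a max of endpoints,
    -- which a monotone map preserves.
    simp only [Function.onFun, uIoc, Ioc_disjoint_Ioc, ← hm.map_min, ← hm.map_max] at hd ⊢
    exact hm hd

/-- An absolutely continuous function is the integral of its derivative, and the integral of a
continuous function is differentiable everywhere. This is needed for p, because `deriv p` takes a
default value wherever p might fail to be differentiable. -/
theorem hasDerivAt_of_continuous_deriv {u : ℝ → ℝ} (hu : LocAC u) (hc : Continuous (deriv u))
    (x : ℝ) : HasDerivAt u (deriv u x) x := by
  have h : u = fun y => u 0 + ∫ t in (0 : ℝ)..y, deriv u t := by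
    funext y
    rw [(hu 0 y).integral_deriv_eq_sub]
    ring
  have h2 := (intervalIntegral.integral_hasDerivAt_right (hc.intervalIntegrable 0 x)
    hc.aestronglyMeasurable.stronglyMeasurableAtFilter hc.continuousAt).const_add (u 0)
  rwa [← h] at h2

end LocAC

/-! ### Unitary equivalence of operators and Paley-Wiener spaces -/

section Unitary

variable {H : Type*} [NormedAddCommGroup H] [InnerProductSpace ℂ H] [CompleteSpace H]

/-- The projection-valued measure `s ↦ U E(s) U⁻¹`. -/
def ProjMeasure.conj (E : ProjMeasure H) (U : H ≃ₗᵢ[ℂ] H) : ProjMeasure H where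
  proj s := (U : H →L[ℂ] H) ∘L E.proj s ∘L (U.symm : H →L[ℂ] H)
  isStarProjection s hs := by
    have h := E.isStarProjection s hs
    refine ⟨?_, ?_⟩
    · ext f
      have := DFunLike.congr_fun h.isIdempotentElem (U.symm f)
      simpa using this
    · rw [ContinuousLinearMap.isSelfAdjoint_iff_isSymmetric]
      intro f g
      have := (ContinuousLinearMap.isSelfAdjoint_iff_isSymmetric.1 h.isSelfAdjoint)
        (U.symm f) (U.symm g)
      have e1 := U.inner_map_map (E.proj s (U.symm f)) (U.symm g)
      have e2 := U.inner_map_map (U.symm f) (E.proj s (U.symm g))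
      simp only [LinearIsometryEquiv.apply_symm_apply] at e1 e2
      exact e1.trans (this.trans e2.symm)
  proj_univ := by
    ext f
    simp [E.proj_univ]
  hasSum_iUnion s hs hd f :=
    (E.hasSum_iUnion s hs hd (U.symm f)).mapL (U : H →L[ℂ] H)

theorem ProjMeasure.conj_proj (E : ProjMeasure H) (U : H ≃ₗᵢ[ℂ] H) (s : Set ℝ) (f : H) :
    (E.conj U).proj s (U f) = U (E.proj s f) := by
  simp [ProjMeasure.conj]

theorem ProjMeasure.scalarMeasure_conj (E : ProjMeasure H) (U : H ≃ₗᵢ[ℂ] H) (f : H) :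
    (E.conj U).scalarMeasure (U f) = E.scalarMeasure f := by
  ext s hs
  simp only [ProjMeasure.scalarMeasure, Measure.ofMeasurable_apply s hs, E.conj_proj,
    LinearIsometryEquiv.norm_map]

/-- Domain and quadratic form are expressed through the scalar measures, which conjugation leaves
unchanged. -/
theorem ProjMeasure.IsSpectralMeasure.conj {E : ProjMeasure H} {A B : H →ₗ.[ℂ] H}
    (hE : E.IsSpectralMeasure A) (U : H ≃ₗᵢ[ℂ] H)
    (hAB : ∀ f g, (f, g) ∈ A.graph ↔ (U f, U g) ∈ B.graph) :
    (E.conj U).IsSpectralMeasure B := by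
  have hdom (f : H) : U f ∈ B.domain ↔ f ∈ A.domain := by
    simp only [LinearPMap.mem_domain_iff]
    constructor
    · rintro ⟨g, hg⟩
      exact ⟨U.symm g, (hAB _ _).2 (by simpa using hg)⟩
    · rintro ⟨g, hg⟩
      exact ⟨U g, (hAB _ _).1 hg⟩
  refine ⟨fun f => ?_, fun f => ?_⟩
  · obtain ⟨f, rfl⟩ := U.surjective f
    rw [hdom, hE.1, E.scalarMeasure_conj]
  · obtain ⟨f, hf⟩ := f
    obtain ⟨f, rfl⟩ := U.surjective f
    have hfA := (hdom f).1 hf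
    have hB : B ⟨U f, hf⟩ = U (A ⟨f, hfA⟩) := by
      have h := (hAB _ _).1 (A.mem_graph ⟨f, hfA⟩)
      exact (LinearPMap.mem_graph_iff' B).1 h |> fun ⟨y, hy⟩ => by
        have h1 : y = ⟨U f, hf⟩ := Subtype.ext (congrArg Prod.fst hy)
        rw [← h1]
        exact congrArg Prod.snd hy
    rw [hB, E.scalarMeasure_conj, U.inner_map_map]
    exact hE.2 ⟨f, hfA⟩

/-- Conjugating the witnessing spectral measure suffices; neither existence nor uniqueness of
spectral measures is used. -/
theorem image_PW_subset {A B : H →ₗ.[ℂ] H} (U : H ≃ₗᵢ[ℂ] H)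
    (hAB : ∀ f g, (f, g) ∈ A.graph ↔ (U f, U g) ∈ B.graph) (Λ : Set ℝ) :
    U '' PW Λ A ⊆ PW Λ B := by
  rintro _ ⟨f, ⟨E, hE, hf⟩, rfl⟩
  exact ⟨E.conj U, hE.conj U hAB, by rw [E.conj_proj, hf]⟩

theorem image_PW {A B : H →ₗ.[ℂ] H} (U : H ≃ₗᵢ[ℂ] H)
    (hAB : ∀ f g, (f, g) ∈ A.graph ↔ (U f, U g) ∈ B.graph) (Λ : Set ℝ) :
    U '' PW Λ A = PW Λ B := by
  refine (image_PW_subset U hAB Λ).antisymm fun g hg => ?_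
  have h := image_PW_subset (A := B) (B := A) U.symm (fun f g => by simp [hAB]) Λ ⟨g, hg, rfl⟩
  exact ⟨U.symm g, h, U.apply_symm_apply g⟩

end Unitary

/-! ### Frames and Riesz sequences under unitaries and rescaling -/

section FrameRiesz

variable {H : Type*} [NormedAddCommGroup H] [InnerProductSpace ℂ H]

theorem IsFrame.map {V : Set H} {ι : Type*} {v : ι → H} (hv : IsFrame V v) (U : H ≃ₗᵢ[ℂ] H)
    {r : ι → ℝ} {m M : ℝ} (hm : 0 < m) (hr : ∀ i, m ≤ r i ∧ r i ≤ M)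
    {w : ι → H} (hw : ∀ i, w i = (r i : ℂ) • U (v i)) (hwV : ∀ i, w i ∈ U '' V) :
    IsFrame (U '' V) w := by
  obtain ⟨-, a, b, ha, hb, h⟩ := hv
  -- The summand 1 keeps the upper bound positive: for an empty index type M may be 0.
  refine ⟨hwV, m ^ 2 * a, (M ^ 2 + 1) * b, by positivity, by positivity, ?_⟩
  rintro _ ⟨f, hf, rfl⟩
  obtain ⟨h1, h2⟩ := h f hf
  have e (i : ι) : ENNReal.ofReal (‖inner ℂ (w i) (U f)‖ ^ 2) =
      ENNReal.ofReal (r i ^ 2) * ENNReal.ofReal (‖inner ℂ (v i) f‖ ^ 2) := by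
    rw [hw, inner_smul_left, U.inner_map_map, norm_mul, mul_pow, RCLike.norm_conj,
      Complex.norm_real, Real.norm_eq_abs, sq_abs, ENNReal.ofReal_mul (sq_nonneg _)]
  simp only [e, U.norm_map]
  constructor
  · rw [mul_assoc, ENNReal.ofReal_mul (sq_nonneg _)]
    refine (mul_le_mul_right h1 _).trans ?_
    rw [← ENNReal.tsum_mul_left]
    refine ENNReal.tsum_le_tsum fun i => mul_le_mul_left (ENNReal.ofReal_le_ofReal ?_) _
    exact pow_le_pow_left₀ hm.le (hr i).1 2
  · rw [mul_assoc, ENNReal.ofReal_mul (by positivity)]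
    refine le_trans ?_ (mul_le_mul_right h2 _)
    rw [← ENNReal.tsum_mul_left]
    refine ENNReal.tsum_le_tsum fun i => mul_le_mul_left (ENNReal.ofReal_le_ofReal ?_) _
    have := pow_le_pow_left₀ (hm.le.trans (hr i).1) (hr i).2 2
    linarith

/-- The weights move into the coefficients: with d_i = c_i r_i, the series ∑ c_i w_i is the image of
∑ d_i v_i, and the ℓ² norms of c and d are comparable. -/
theorem IsRieszSequence.map {V : Set H} {ι : Type*} {v : ι → H} (hv : IsRieszSequence V v)
    (U : H ≃ₗᵢ[ℂ] H) {r : ι → ℝ} {m M : ℝ} (hm : 0 < m) (hr : ∀ i, m ≤ r i ∧ r i ≤ M)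
    {w : ι → H} (hw : ∀ i, w i = (r i : ℂ) • U (v i)) (hwV : ∀ i, w i ∈ U '' V) :
    IsRieszSequence (U '' V) w := by
  obtain ⟨-, a, b, ha, hb, h⟩ := hv
  refine ⟨hwV, a * m ^ 2, b * (M ^ 2 + 1), by positivity, by positivity, fun c hc => ?_⟩
  set d : ι → ℂ := fun i => c i * (r i : ℂ) with hd
  have hdn (i : ι) : ‖d i‖ ^ 2 = r i ^ 2 * ‖c i‖ ^ 2 := by
    rw [hd, norm_mul, mul_pow, Complex.norm_real, Real.norm_eq_abs, sq_abs, mul_comm]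
  have hlow (i : ι) : m ^ 2 * ‖c i‖ ^ 2 ≤ ‖d i‖ ^ 2 := by
    rw [hdn]
    exact mul_le_mul_of_nonneg_right (pow_le_pow_left₀ hm.le (hr i).1 2) (sq_nonneg _)
  have hupp (i : ι) : ‖d i‖ ^ 2 ≤ (M ^ 2 + 1) * ‖c i‖ ^ 2 := by
    rw [hdn]
    have := pow_le_pow_left₀ (hm.le.trans (hr i).1) (hr i).2 2
    exact mul_le_mul_of_nonneg_right (by linarith) (sq_nonneg _)
  have hds : Summable fun i => ‖d i‖ ^ 2 :=
    (hc.mul_left (M ^ 2 + 1)).of_nonneg_of_le (fun i => sq_nonneg _) hupp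
  obtain ⟨h1, h2, h3⟩ := h d hds
  have e (i : ι) : c i • w i = U (d i • v i) := by
    rw [hw, smul_smul, U.map_smul]
  have hs : HasSum (fun i => c i • w i) (U (∑' i, d i • v i)) := by
    simp only [e]
    exact h1.hasSum.mapL (U : H →L[ℂ] H)
  have hl := (hc.mul_left (m ^ 2)).tsum_le_tsum hlow hds
  have hu := hds.tsum_le_tsum hupp (hc.mul_left (M ^ 2 + 1))
  rw [tsum_mul_left] at hl hu
  rw [hs.tsum_eq, U.norm_map]
  refine ⟨hs.summable, ?_, ?_⟩
  · rw [mul_assoc]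
    exact (mul_le_mul_of_nonneg_left hl ha.le).trans h2
  · rw [mul_assoc]
    exact h3.trans (mul_le_mul_of_nonneg_left hu hb.le)

end FrameRiesz

/-- Two continuous representatives of the same f agree everywhere, so k(x,·) and k'(x,·) have the
same inner products with V. -/
theorem IsReproducingKernel.unique {V : Set L2} {k k' : ℝ → L2} (hk : IsReproducingKernel V k)
    (hk' : IsReproducingKernel V k') : k = k' := by
  have key (f : L2) (hf : f ∈ V) (x : ℝ) : inner ℂ (k x) f = inner ℂ (k' x) f := by
    obtain ⟨c1, e1⟩ := hk.2 f hf
    obtain ⟨c2, e2⟩ := hk'.2 f hf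
    exact congrFun (Measure.eq_of_ae_eq (e1.symm.trans e2) c1 c2) x
  funext x
  -- V is only a set, so the difference need not lie in it; the expanded square tests only against
  -- k(x,·) and k'(x,·).
  rw [← sub_eq_zero, ← inner_self_eq_zero (𝕜 := ℂ), inner_sub_right, inner_sub_left,
    inner_sub_left, key _ (hk.1 x), key _ (hk'.1 x)]
  ring

/-! ### Densities -/

section Density

variable {p : ℝ → ℝ}

theorem muP_Icc (hp : Continuous p) (hpos : ∀ x, 0 < p x) (hζ : Function.Surjective (zeta p))
    (a b : ℝ) : muP p (Icc a b) = volume (Icc (zeta p a) (zeta p b)) := by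
  have hmono := strictMono_zeta hp hpos
  have himg : zeta p '' Icc a b = Icc (zeta p a) (zeta p b) := by
    ext y
    obtain ⟨x, rfl⟩ := hζ y
    simp [hmono.injective.eq_iff, hmono.le_iff_le]
  have h := lintegral_image_eq_lintegral_abs_deriv_mul (s := Icc a b) measurableSet_Icc
    (fun x _ => (hasDerivAt_zeta hp hpos x).hasDerivWithinAt) hmono.injective.injOn (fun _ => 1)
  rw [himg, setLIntegral_one] at h
  rw [h, muP, withDensity_apply _ measurableSet_Icc]
  refine lintegral_congr fun x => ?_
  rw [mul_one, abs_of_pos (Real.rpow_pos_of_pos (hpos x) _)]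

theorem encard_image_zeta_inter_Icc (hp : Continuous p) (hpos : ∀ x, 0 < p x)
    (X : Set ℝ) (a b : ℝ) :
    (zeta p '' X ∩ Icc (zeta p a) (zeta p b)).encard = (X ∩ Icc a b).encard := by
  have hmono := strictMono_zeta hp hpos
  rw [← hmono.injective.encard_image (X ∩ Icc a b)]
  congr 1
  ext y
  constructor
  · rintro ⟨⟨x, hx, rfl⟩, h1, h2⟩
    exact ⟨x, ⟨hx, hmono.le_iff_le.1 h1, hmono.le_iff_le.1 h2⟩, rfl⟩
  · rintro ⟨x, ⟨hx, h1, h2⟩, rfl⟩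
    exact ⟨⟨x, hx, rfl⟩, hmono.le_iff_le.2 h1, hmono.le_iff_le.2 h2⟩

/-- The quantities agree for each r before any limit: surjectivity of ζ reindexes the endpoints,
matching both lengths and counts. -/
theorem upperDensity_muP (hp : Continuous p) (hpos : ∀ x, 0 < p x)
    (hζ : Function.Surjective (zeta p)) (X : Set ℝ) :
    upperDensity (muP p) X = upperDensity volume (zeta p '' X) := by
  unfold upperDensity
  congr 1
  funext r
  refine hζ.iSup_congr _ fun a => (hζ.iSup_congr _ fun b => ?_).symm
  rw [muP_Icc hp hpos hζ, encard_image_zeta_inter_Icc hp hpos]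

theorem lowerDensity_muP (hp : Continuous p) (hpos : ∀ x, 0 < p x)
    (hζ : Function.Surjective (zeta p)) (X : Set ℝ) :
    lowerDensity (muP p) X = lowerDensity volume (zeta p '' X) := by
  unfold lowerDensity
  congr 1
  funext r
  refine hζ.iInf_congr _ fun a => (hζ.iInf_congr _ fun b => ?_).symm
  rw [muP_Icc hp hpos hζ, encard_image_zeta_inter_Icc hp hpos]

end Density

/-! ### The Liouville transform as a unitary operator -/

section Liouville

variable {p : ℝ → ℝ}

theorem zetaInv_zeta (hp : Continuous p) (hpos : ∀ x, 0 < p x) (x : ℝ) :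
    zetaInv p (zeta p x) = x :=
  Function.leftInverse_invFun (strictMono_zeta hp hpos).injective x

theorem zeta_zetaInv (hζ : Function.Surjective (zeta p)) (y : ℝ) : zeta p (zetaInv p y) = y :=
  Function.rightInverse_invFun hζ y

theorem strictMono_zetaInv (hp : Continuous p) (hpos : ∀ x, 0 < p x)
    (hζ : Function.Surjective (zeta p)) : StrictMono (zetaInv p) := fun a b hab => by
  rwa [← (strictMono_zeta hp hpos).lt_iff_lt, zeta_zetaInv hζ, zeta_zetaInv hζ]

theorem continuous_zetaInv (hp : Continuous p) (hpos : ∀ x, 0 < p x)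
    (hζ : Function.Surjective (zeta p)) : Continuous (zetaInv p) :=
  (strictMono_zetaInv hp hpos hζ).monotone.continuous_of_surjective
    fun x => ⟨zeta p x, zetaInv_zeta hp hpos x⟩

theorem hasDerivAt_zetaInv (hp : Continuous p) (hpos : ∀ x, 0 < p x)
    (hζ : Function.Surjective (zeta p)) (y : ℝ) :
    HasDerivAt (zetaInv p) (p (zetaInv p y) ^ (-(1 / 2) : ℝ))⁻¹ y :=
  (hasDerivAt_zeta hp hpos _).of_local_left_inverse
    (continuous_zetaInv hp hpos hζ).continuousAt
    (Real.rpow_pos_of_pos (hpos _) _).ne' (Eventually.of_forall (zeta_zetaInv hζ))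

theorem continuous_rpow_comp (hp : Continuous p) (hpos : ∀ x, 0 < p x) (s : ℝ) :
    Continuous fun x => p x ^ s :=
  hp.rpow_const fun x => Or.inl (hpos x).ne'

theorem locAC_zeta (hp : Continuous p) (hpos : ∀ x, 0 < p x) : LocAC (zeta p) := by
  refine LocAC.of_contDiff (contDiff_one_iff_deriv.2
    ⟨fun x => (hasDerivAt_zeta hp hpos x).differentiableAt, ?_⟩)
  rw [funext fun x => (hasDerivAt_zeta hp hpos x).deriv]
  exact continuous_rpow_comp hp hpos _

theorem locAC_zetaInv (hp : Continuous p) (hpos : ∀ x, 0 < p x)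
    (hζ : Function.Surjective (zeta p)) : LocAC (zetaInv p) := by
  refine LocAC.of_contDiff (contDiff_one_iff_deriv.2
    ⟨fun x => (hasDerivAt_zetaInv hp hpos hζ x).differentiableAt, ?_⟩)
  rw [funext fun x => (hasDerivAt_zetaInv hp hpos hζ x).deriv]
  exact ((continuous_rpow_comp hp hpos _).comp (continuous_zetaInv hp hpos hζ)).inv₀
    fun x => (Real.rpow_pos_of_pos (hpos _) _).ne'

/-- Both ζ and its inverse are differentiable, hence map null sets to null sets. Almost everywhere
statements in y can thus be checked at y = ζ(x). -/
theorem ae_comp_zeta_iff (hp : Continuous p) (hpos : ∀ x, 0 < p x)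
    (hζ : Function.Surjective (zeta p)) {P : ℝ → Prop} :
    (∀ᵐ y, P y) ↔ ∀ᵐ x, P (zeta p x) := by
  simp only [ae_iff]
  constructor <;> intro h
  · have := addHaar_image_eq_zero_of_differentiableOn_of_addHaar_eq_zero volume
      (fun y _ => (hasDerivAt_zetaInv hp hpos hζ y).differentiableAt.differentiableWithinAt) h
    refine measure_mono_null (fun x hx => ?_) this
    exact ⟨zeta p x, hx, zetaInv_zeta hp hpos x⟩
  · have := addHaar_image_eq_zero_of_differentiableOn_of_addHaar_eq_zero volume
      (fun y _ => (hasDerivAt_zeta hp hpos y).differentiableAt.differentiableWithinAt) h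
    refine measure_mono_null (fun y hy => ?_) this
    obtain ⟨x, rfl⟩ := hζ y
    exact ⟨x, hy, rfl⟩

theorem liouvilleFun_zeta (hp : Continuous p) (hpos : ∀ x, 0 < p x) (f : ℝ → ℂ) (x : ℝ) :
    liouvilleFun p f (zeta p x) = ((p x ^ (1 / 4 : ℝ) : ℝ) : ℂ) * f x := by
  rw [liouvilleFun, zetaInv_zeta hp hpos]

theorem eLpNorm_liouvilleFun (hp : Continuous p) (hpos : ∀ x, 0 < p x)
    (hζ : Function.Surjective (zeta p)) (f : ℝ → ℂ) :
    eLpNorm (liouvilleFun p f) 2 volume = eLpNorm f 2 volume := by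
  rw [eLpNorm_eq_lintegral_rpow_enorm_toReal two_ne_zero ENNReal.ofNat_ne_top,
    eLpNorm_eq_lintegral_rpow_enorm_toReal two_ne_zero ENNReal.ofNat_ne_top]
  congr 1
  have hcv := lintegral_image_eq_lintegral_abs_deriv_mul (s := univ) MeasurableSet.univ
    (fun x _ => (hasDerivAt_zeta hp hpos x).hasDerivWithinAt)
    (strictMono_zeta hp hpos).injective.injOn
    (fun y => ‖liouvilleFun p f y‖ₑ ^ (2 : ℝ≥0∞).toReal)
  rw [image_univ, hζ.range_eq, Measure.restrict_univ] at hcv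
  rw [hcv]
  refine lintegral_congr fun x => ?_
  have hx := hpos x
  have e : |p x ^ (-(1 / 2) : ℝ)| * (p x ^ (1 / 4 : ℝ)) ^ 2 = 1 := by
    rw [abs_of_pos (Real.rpow_pos_of_pos hx _), ← Real.rpow_natCast, ← Real.rpow_mul hx.le,
      ← Real.rpow_add hx]
    norm_num
  have e' : ‖((p x ^ (1 / 4 : ℝ) : ℝ) : ℂ)‖ₑ = ENNReal.ofReal (p x ^ (1 / 4 : ℝ)) := by
    rw [← ofReal_norm, Complex.norm_real, Real.norm_of_nonneg (by positivity)]
  rw [liouvilleFun_zeta hp hpos]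
  simp only [enorm_mul, e', ENNReal.toReal_ofNat, ENNReal.rpow_ofNat]
  rw [mul_pow, ← mul_assoc, ← ENNReal.ofReal_pow (by positivity),
    ← ENNReal.ofReal_mul (abs_nonneg _), e, ENNReal.ofReal_one, one_mul]

theorem coeFn_liouville (hp : Continuous p) (hpos : ∀ x, 0 < p x)
    (hζ : Function.Surjective (zeta p)) (f : L2) :
    (liouville p f : ℝ → ℂ) =ᵐ[volume] liouvilleFun p f := by
  have h := memLp_liouvilleFun hp hpos hζ f
  rw [liouville, dif_pos h]
  exact h.coeFn_toLp

theorem liouville_zeta (hp : Continuous p) (hpos : ∀ x, 0 < p x)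
    (hζ : Function.Surjective (zeta p)) (f : L2) :
    ∀ᵐ x, (liouville p f : ℝ → ℂ) (zeta p x) = ((p x ^ (1 / 4 : ℝ) : ℝ) : ℂ) * f x := by
  filter_upwards [(ae_comp_zeta_iff hp hpos hζ).1 (coeFn_liouville hp hpos hζ f)] with x hx
  rw [hx, liouvilleFun_zeta hp hpos]

/-- This description avoids ζ⁻¹; linearity and surjectivity of the transform are read off from it.
-/
theorem eq_liouville_iff (hp : Continuous p) (hpos : ∀ x, 0 < p x)
    (hζ : Function.Surjective (zeta p)) (f g : L2) :
    g = liouville p f ↔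
      ∀ᵐ x, (g : ℝ → ℂ) (zeta p x) = ((p x ^ (1 / 4 : ℝ) : ℝ) : ℂ) * f x := by
  refine ⟨fun h => h ▸ liouville_zeta hp hpos hζ f, fun h => Lp.ext ?_⟩
  refine (ae_comp_zeta_iff hp hpos hζ).2 ?_
  filter_upwards [h, liouville_zeta hp hpos hζ f] with x h1 h2
  rw [h1, h2]

theorem norm_liouville (hp : Continuous p) (hpos : ∀ x, 0 < p x)
    (hζ : Function.Surjective (zeta p)) (f : L2) : ‖liouville p f‖ = ‖f‖ := by
  rw [Lp.norm_def, Lp.norm_def, eLpNorm_congr_ae (coeFn_liouville hp hpos hζ f),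
    eLpNorm_liouvilleFun hp hpos hζ]

theorem surjective_liouville (hp : Continuous p) (hpos : ∀ x, 0 < p x)
    (hζ : Function.Surjective (zeta p)) : Function.Surjective (liouville p) := by
  intro g
  set f : ℝ → ℂ := fun x => (((p x ^ (1 / 4 : ℝ))⁻¹ : ℝ) : ℂ) * g (zeta p x) with hf
  have hr (x : ℝ) : ((p x ^ (1 / 4 : ℝ) : ℝ) : ℂ) ≠ 0 :=
    Complex.ofReal_ne_zero.2 (Real.rpow_pos_of_pos (hpos x) _).ne'
  have hgf : liouvilleFun p f = g := by
    funext y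
    obtain ⟨x, rfl⟩ := hζ y
    rw [liouvilleFun_zeta hp hpos]
    simp only [hf, Complex.ofReal_inv, mul_inv_cancel_left₀ (hr x)]
  have hm : Measurable f :=
    (Complex.measurable_ofReal.comp (hp.measurable.pow_const _).inv).mul
      ((Lp.stronglyMeasurable g).measurable.comp (strictMono_zeta hp hpos).monotone.measurable)
  have hfm : MemLp f 2 volume := by
    refine ⟨hm.aestronglyMeasurable, ?_⟩
    rw [← eLpNorm_liouvilleFun hp hpos hζ, hgf]
    exact (Lp.memLp g).2
  refine ⟨hfm.toLp f, ((eq_liouville_iff hp hpos hζ _ _).2 ?_).symm⟩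
  filter_upwards [hfm.coeFn_toLp] with x hx
  rw [hx]
  simp only [hf, Complex.ofReal_inv, mul_inv_cancel_left₀ (hr x)]

/-- The Liouville transform as a unitary operator on `L²(ℝ)`. -/
def liouvilleEquiv (hp : Continuous p) (hpos : ∀ x, 0 < p x)
    (hζ : Function.Surjective (zeta p)) : L2 ≃ₗᵢ[ℂ] L2 :=
  LinearIsometryEquiv.ofSurjective
    { toFun := liouville p
      map_add' := fun f g => by
        refine ((eq_liouville_iff hp hpos hζ _ _).2 ?_).symm
        filter_upwards [liouville_zeta hp hpos hζ f, liouville_zeta hp hpos hζ g,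
          Lp.coeFn_add f g, (ae_comp_zeta_iff hp hpos hζ).1
            (Lp.coeFn_add (liouville p f) (liouville p g))] with x h1 h2 h3 h4
        rw [h4, h3, Pi.add_apply, Pi.add_apply, h1, h2, mul_add]
      map_smul' := fun c f => by
        refine ((eq_liouville_iff hp hpos hζ _ _).2 ?_).symm
        filter_upwards [liouville_zeta hp hpos hζ f, Lp.coeFn_smul c f,
          (ae_comp_zeta_iff hp hpos hζ).1 (Lp.coeFn_smul c (liouville p f))] with x h1 h3 h4
        rw [RingHom.id_apply, h4, h3, Pi.smul_apply, Pi.smul_apply, h1, smul_eq_mul, smul_eq_mul,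
          mul_left_comm]
      norm_map' := norm_liouville hp hpos hζ }
    (surjective_liouville hp hpos hζ)

end Liouville

/-! ### The Liouville transform of the Sturm-Liouville operator -/

section Graph

variable {p : ℝ → ℝ}

theorem rpow_quarter_pow_four (hpos : ∀ x, 0 < p x) (x : ℝ) : (p x ^ (1 / 4 : ℝ)) ^ 4 = p x := by
  rw [← Real.rpow_natCast, ← Real.rpow_mul (hpos x).le]
  norm_num

theorem rpow_neg_half_eq (hpos : ∀ x, 0 < p x) (x : ℝ) :
    p x ^ (-(1 / 2) : ℝ) = ((p x ^ (1 / 4 : ℝ)) ^ 2)⁻¹ := by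
  rw [Real.rpow_neg (hpos x).le, ← Real.rpow_natCast, ← Real.rpow_mul (hpos x).le]
  norm_num

theorem hasDerivAt_rpow_quarter (hp : LocAC p) (hp' : LocAC (deriv p)) (hpos : ∀ x, 0 < p x)
    (x : ℝ) :
    HasDerivAt (fun x => p x ^ (1 / 4 : ℝ)) (deriv p x / (4 * (p x ^ (1 / 4 : ℝ)) ^ 3)) x := by
  convert! (hp.hasDerivAt_of_continuous_deriv hp'.continuous x).rpow_const (p := 1 / 4)
    (Or.inl (hpos x).ne') using 1
  have e : p x ^ ((1 / 4 : ℝ) - 1) = ((p x ^ (1 / 4 : ℝ)) ^ 3)⁻¹ := by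
    rw [← Real.rpow_natCast, ← Real.rpow_mul (hpos x).le, ← Real.rpow_neg (hpos x).le]
    norm_num
  rw [e]
  field_simp

theorem contDiff_rpow_quarter (hp : LocAC p) (hp' : LocAC (deriv p)) (hpos : ∀ x, 0 < p x) :
    ContDiff ℝ 1 fun x => p x ^ (1 / 4 : ℝ) := by
  refine ContDiff.rpow_const_of_ne (contDiff_one_iff_deriv.2 ⟨fun x =>
    (hp.hasDerivAt_of_continuous_deriv hp'.continuous x).differentiableAt, hp'.continuous⟩)
    fun x => (hpos x).ne'

theorem locAC_inv_rpow_quarter (hp : LocAC p) (hp' : LocAC (deriv p)) (hpos : ∀ x, 0 < p x) :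
    LocAC fun x => (p x ^ (1 / 4 : ℝ))⁻¹ :=
  LocAC.of_contDiff ((contDiff_rpow_quarter hp hp' hpos).inv
    fun x => (Real.rpow_pos_of_pos (hpos x) _).ne')

theorem hasDerivAt_comp_zetaInv (hp : Continuous p) (hpos : ∀ x, 0 < p x)
    (hζ : Function.Surjective (zeta p)) {F : ℝ → ℂ} {D : ℂ} {x : ℝ} (h : HasDerivAt F D x) :
    HasDerivAt (fun y => F (zetaInv p y)) (((p x ^ (1 / 4 : ℝ) : ℝ) : ℂ) ^ 2 * D) (zeta p x) := by
  have h1 := hasDerivAt_zetaInv hp hpos hζ (zeta p x)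
  rw [zetaInv_zeta hp hpos, rpow_neg_half_eq hpos, inv_inv] at h1
  rw [← zetaInv_zeta hp hpos x] at h
  convert! h.scomp (zeta p x) h1 using 1
  rw [Complex.real_smul]
  push_cast
  rfl

theorem hasDerivAt_comp_zeta (hp : Continuous p) (hpos : ∀ x, 0 < p x)
    {F : ℝ → ℂ} {D : ℂ} {x : ℝ} (h : HasDerivAt F D (zeta p x)) :
    HasDerivAt (fun x => F (zeta p x)) ((((p x ^ (1 / 4 : ℝ) : ℝ) : ℂ) ^ 2)⁻¹ * D) x := by
  have h1 := hasDerivAt_zeta hp hpos x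
  rw [rpow_neg_half_eq hpos] at h1
  convert! h.scomp x h1 using 1
  rw [Complex.real_smul]
  push_cast
  rfl

theorem potential_zeta (hp : Continuous p) (hpos : ∀ x, 0 < p x) (x : ℝ) :
    potential p (zeta p x) = deriv (deriv p) x / 4 - deriv p x ^ 2 / (16 * p x) := by
  rw [potential, zetaInv_zeta hp hpos]

/-- The Liouville transform maps the graph of `-(p f')'` into the graph of `-f'' + q f`. -/
theorem liouville_mem_slGraph (hp : LocAC p) (hp' : LocAC (deriv p)) (hpos : ∀ x, 0 < p x)
    (hζ : Function.Surjective (zeta p)) {f g : L2} (h : (f, g) ∈ slGraph p fun _ => 0) :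
    (liouville p f, liouville p g) ∈ slGraph (fun _ => 1) (potential p) := by
  have hpc := hp.continuous
  obtain ⟨u, v, hu, hv, hf, hpu, hg⟩ := h
  -- Keeping r = p^{1/4} opaque, with p = r⁴ and r' = p'/(4r³), reduces the calculus below to
  -- rational identities in r.
  obtain ⟨r, hr⟩ : ∃ r : ℝ → ℝ, ∀ x, p x ^ (1 / 4 : ℝ) = r x := ⟨_, fun _ => rfl⟩
  have hr0 (x : ℝ) : r x ≠ 0 := hr x ▸ (Real.rpow_pos_of_pos (hpos x) _).ne'
  have hp4 (x : ℝ) : (p x : ℂ) = (r x : ℂ) ^ 4 := by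
    rw [← hr, ← Complex.ofReal_pow, rpow_quarter_pow_four hpos]
  have hrAC := LocAC.of_contDiff (contDiff_rpow_quarter hp hp' hpos)
  have hriAC := locAC_inv_rpow_quarter hp hp' hpos
  have hdr := hasDerivAt_rpow_quarter hp hp' hpos
  have hUf := liouville_zeta hpc hpos hζ f
  have hUg := liouville_zeta hpc hpos hζ g
  have hcomp {F : ℝ → ℂ} {D : ℂ} {x : ℝ} (h : HasDerivAt F D x) :=
    hasDerivAt_comp_zetaInv hpc hpos hζ h
  simp only [hr] at hrAC hriAC hdr hUf hUg hcomp
  have hφ := locAC_zetaInv hpc hpos hζ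
  have hφm := (strictMono_zetaInv hpc hpos hζ).monotone
  set w : ℝ → ℂ := fun x => (r x : ℂ) * u x with hw
  -- Since d/dy = r² d/dx, the y-derivative of w is r²(ru)' = r⁻¹(p'u/4 + pu'). Replacing pu' by v
  -- makes it visibly absolutely continuous.
  set z : ℝ → ℂ := fun x => (((r x)⁻¹ : ℝ) : ℂ) * (((deriv p x : ℝ) : ℂ) * ((1 / 4 : ℂ) * u x)
    + v x) with hz
  have hwAC : LocAC w := hrAC.ofReal_mul hu
  have hzAC : LocAC z :=
    hriAC.ofReal_mul ((hp'.ofReal_mul fun a b => (hu a b).const_smul (1 / 4 : ℂ)).add hv)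
  refine ⟨fun y => w (zetaInv p y), fun y => z (zetaInv p y), hwAC.comp_monotone hφ hφm,
    hzAC.comp_monotone hφ hφm, ?_, ?_, ?_⟩
  · refine (ae_comp_zeta_iff hpc hpos hζ).2 ?_
    filter_upwards [hUf, hf] with x h1 h2
    rw [h1, h2, zetaInv_zeta hpc hpos]
  · refine (ae_comp_zeta_iff hpc hpos hζ).2 ?_
    filter_upwards [hpu, hu.ae_differentiableAt] with x h1 h2
    have hd : HasDerivAt w _ x := (hdr x).ofReal_comp.mul h2.hasDerivAt
    have hR := Complex.ofReal_ne_zero.2 (hr0 x)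
    rw [(hcomp hd).deriv, zetaInv_zeta hpc hpos]
    simp only [hz, h1, hp4 x]
    push_cast
    field_simp
  · refine (ae_comp_zeta_iff hpc hpos hζ).2 ?_
    filter_upwards [hpu, hu.ae_differentiableAt, hv.ae_differentiableAt,
      hp'.ae_differentiableAt_real, hg, hUg] with x h1 h2 h3 h4 h5 h6
    -- In r²z' the terms ±p'v/(4r³) cancel, leaving rv' + (p''/4 - p'²/(16p))ru, that is, rv' + qw.
    have hd : HasDerivAt z _ x := ((hdr x).fun_inv (hr0 x)).ofReal_comp.mul
      ((h4.hasDerivAt.ofReal_comp.mul (h2.hasDerivAt.const_mul (1 / 4 : ℂ))).add h3.hasDerivAt)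
    have hR := Complex.ofReal_ne_zero.2 (hr0 x)
    rw [(hcomp hd).deriv, zetaInv_zeta hpc hpos, potential_zeta hpc hpos, h6, h5]
    push_cast
    simp only [hw, h1, hp4 x]
    field_simp
    ring

/-- The inverse Liouville transform maps the graph of `-f'' + q f` into the graph of
`-(p f')'`. -/
theorem mem_slGraph_of_liouville (hp : LocAC p) (hp' : LocAC (deriv p)) (hpos : ∀ x, 0 < p x)
    (hζ : Function.Surjective (zeta p)) {f g : L2}
    (h : (liouville p f, liouville p g) ∈ slGraph (fun _ => 1) (potential p)) :
    (f, g) ∈ slGraph p fun _ => 0 := by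
  have hpc := hp.continuous
  obtain ⟨w, z, hw, hz, hf, hwz, hg⟩ := h
  obtain ⟨r, hr⟩ : ∃ r : ℝ → ℝ, ∀ x, p x ^ (1 / 4 : ℝ) = r x := ⟨_, fun _ => rfl⟩
  have hr0 (x : ℝ) : r x ≠ 0 := hr x ▸ (Real.rpow_pos_of_pos (hpos x) _).ne'
  have hp4 (x : ℝ) : (p x : ℂ) = (r x : ℂ) ^ 4 := by
    rw [← hr, ← Complex.ofReal_pow, rpow_quarter_pow_four hpos]
  have hrAC := LocAC.of_contDiff (contDiff_rpow_quarter hp hp' hpos)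
  have hriAC := locAC_inv_rpow_quarter hp hp' hpos
  have hdr := hasDerivAt_rpow_quarter hp hp' hpos
  have hUf := liouville_zeta hpc hpos hζ f
  have hUg := liouville_zeta hpc hpos hζ g
  have hcomp {F : ℝ → ℂ} {D : ℂ} {x : ℝ} (h : HasDerivAt F D (zeta p x)) :=
    hasDerivAt_comp_zeta hpc hpos h
  simp only [hr] at hrAC hriAC hdr hUf hUg hcomp
  have hζm := (strictMono_zeta hpc hpos).monotone
  have hwζ := hw.comp_monotone (locAC_zeta hpc hpos) hζm
  have hzζ := hz.comp_monotone (locAC_zeta hpc hpos) hζm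
  have hdw := (ae_comp_zeta_iff hpc hpos hζ).1 hw.ae_differentiableAt
  have hdz := (ae_comp_zeta_iff hpc hpos hζ).1 hz.ae_differentiableAt
  replace hwz := (ae_comp_zeta_iff hpc hpos hζ).1 hwz
  replace hf := (ae_comp_zeta_iff hpc hpos hζ).1 hf
  replace hg := (ae_comp_zeta_iff hpc hpos hζ).1 hg
  set u : ℝ → ℂ := fun x => (((r x)⁻¹ : ℝ) : ℂ) * w (zeta p x) with hu
  -- This is pu' for u = r⁻¹ w∘ζ: r⁴(-r'r⁻² w + r⁻³ z) = -p'w/(4r) + rz.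
  set v : ℝ → ℂ := fun x => (((r x)⁻¹ : ℝ) : ℂ) * (((deriv p x : ℝ) : ℂ) *
    ((-1 / 4 : ℂ) * w (zeta p x))) + (r x : ℂ) * z (zeta p x) with hv
  have huAC : LocAC u := hriAC.ofReal_mul hwζ
  have hvAC : LocAC v :=
    (hriAC.ofReal_mul (hp'.ofReal_mul fun a b => (hwζ a b).const_smul (-1 / 4 : ℂ))).add
      (hrAC.ofReal_mul hzζ)
  have hdri (x : ℝ) := ((hdr x).fun_inv (hr0 x)).ofReal_comp
  refine ⟨u, v, huAC, hvAC, ?_, ?_, ?_⟩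
  · filter_upwards [hUf, hf] with x h1 h2
    simp only [hu, ← h2, h1, Complex.ofReal_inv]
    exact (inv_mul_cancel_left₀ (Complex.ofReal_ne_zero.2 (hr0 x)) _).symm
  · filter_upwards [hwz, hdw] with x h1 h2
    have hd : HasDerivAt u _ x := (hdri x).mul (hcomp h2.hasDerivAt)
    have hR := Complex.ofReal_ne_zero.2 (hr0 x)
    rw [hd.deriv]
    simp only [hv, h1, hp4 x]
    push_cast
    field_simp
  · filter_upwards [hwz, hdw, hdz, hp'.ae_differentiableAt_real, hg, hUg] with x h1 h2 h3 h4 h5 h6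
    have hd : HasDerivAt v _ x := ((hdri x).mul (h4.hasDerivAt.ofReal_comp.mul
      ((hcomp h2.hasDerivAt).const_mul (-1 / 4 : ℂ)))).add
      ((hdr x).ofReal_comp.mul (hcomp h3.hasDerivAt))
    have hR := Complex.ofReal_ne_zero.2 (hr0 x)
    rw [hd.deriv]
    -- The known equation concerns (Ug)(ζ(x)) = r(x)g(x), so the goal is first multiplied by r.
    apply mul_left_cancel₀ hR
    rw [← h6, h5, potential_zeta hpc hpos]
    simp only [h1, Pi.mul_apply]
    push_cast
    simp only [hp4 x]
    field_simp
    ring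

theorem liouville_image_PW (hp : LocAC p) (hp' : LocAC (deriv p)) (hpos : ∀ x, 0 < p x)
    (hζ : Function.Surjective (zeta p)) (Λ : Set ℝ) :
    liouville p '' PW Λ (opA p) = PW Λ (opB (potential p)) := by
  refine image_PW (liouvilleEquiv hp.continuous hpos hζ) (fun f g => ?_) Λ
  rw [opA, opB, slOperator_graph, slOperator_graph]
  exact ⟨liouville_mem_slGraph hp hp' hpos hζ, mem_slGraph_of_liouville hp hp' hpos hζ⟩

end Graph

/-! ### Reproducing kernels under the Liouville transform, and surjectivity of ζ -/

section Kernel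

variable {p : ℝ → ℝ}

/-- The Liouville transform of a reproducing kernel is a reproducing kernel. -/
theorem IsReproducingKernel.liouville (hp : Continuous p) (hpos : ∀ x, 0 < p x)
    (hζ : Function.Surjective (zeta p)) {V : Set L2}
    (hV : ∀ (c : ℂ), ∀ f ∈ V, c • f ∈ V) {k : ℝ → L2} (hk : IsReproducingKernel V k) :
    IsReproducingKernel (VariableBandwidth.liouville p '' V) fun y =>
      ((p (zetaInv p y) ^ (1 / 4 : ℝ) : ℝ) : ℂ) •
        VariableBandwidth.liouville p (k (zetaInv p y)) := by
  set U := liouvilleEquiv hp hpos hζ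
  have hU (f : L2) : VariableBandwidth.liouville p f = U f := rfl
  refine ⟨fun y => ⟨_, hV ((p (zetaInv p y) ^ (1 / 4 : ℝ) : ℝ) : ℂ) _ (hk.1 (zetaInv p y)), ?_⟩,
    ?_⟩
  · exact U.map_smul _ _
  · rintro _ ⟨f, hf, rfl⟩
    -- By unitarity this inner product is p^{1/4}⟨f, k(x,·)⟩ with x = ζ⁻¹(y). The weight on the
    -- kernel thus supplies the factor p^{1/4} in Uf.
    have e (y : ℝ) : inner ℂ (((p (zetaInv p y) ^ (1 / 4 : ℝ) : ℝ) : ℂ) •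
        VariableBandwidth.liouville p (k (zetaInv p y))) (VariableBandwidth.liouville p f) =
        ((p (zetaInv p y) ^ (1 / 4 : ℝ) : ℝ) : ℂ) * inner ℂ (k (zetaInv p y)) f := by
      rw [inner_smul_left, hU, hU, U.inner_map_map, Complex.conj_ofReal]
    simp only [e]
    obtain ⟨hc, hae⟩ := hk.2 f hf
    have hφ := continuous_zetaInv hp hpos hζ
    refine ⟨(Complex.continuous_ofReal.comp ((continuous_rpow_comp hp hpos _).comp hφ)).mul
      (hc.comp hφ), (ae_comp_zeta_iff hp hpos hζ).2 ?_⟩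
    filter_upwards [hae, liouville_zeta hp hpos hζ f] with x h1 h2
    rw [h2, h1, zetaInv_zeta hp hpos]

theorem smul_mem_PW {H : Type*} [NormedAddCommGroup H] [InnerProductSpace ℂ H] [CompleteSpace H]
    {Λ : Set ℝ} {A : H →ₗ.[ℂ] H} (c : ℂ) {f : H} (hf : f ∈ PW Λ A) : c • f ∈ PW Λ A := by
  obtain ⟨E, hE, h⟩ := hf
  exact ⟨E, hE, by rw [map_smul, h]⟩

theorem reproducingKernel_liouville (hp : LocAC p) (hp' : LocAC (deriv p)) (hpos : ∀ x, 0 < p x)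
    (hζ : Function.Surjective (zeta p)) {Λ : Set ℝ} {k h : ℝ → L2}
    (hk : IsReproducingKernel (PW Λ (opA p)) k)
    (hh : IsReproducingKernel (PW Λ (opB (potential p))) h) (x : ℝ) :
    h (zeta p x) = ((p x ^ (1 / 4 : ℝ) : ℝ) : ℂ) • liouville p (k x) := by
  have hk' := hk.liouville hp.continuous hpos hζ fun c f hf => smul_mem_PW c hf
  rw [liouville_image_PW hp hp' hpos hζ] at hk'
  have := congrFun (hh.unique hk') (zeta p x)
  simpa only [zetaInv_zeta hp.continuous hpos] using this

/-- If `p` is bounded above, then `ζ` is onto. -/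
theorem surjective_zeta_of_le (hp : Continuous p) (hpos : ∀ x, 0 < p x) {C : ℝ}
    (hC : ∀ x, p x ≤ C) : Function.Surjective (zeta p) := by
  have hC0 : 0 < C := (hpos 0).trans_le (hC 0)
  set m := C ^ (-(1 / 2) : ℝ)
  have hm : 0 < m := Real.rpow_pos_of_pos hC0 _
  -- Here m = C^{-1/2} bounds ζ' from below, so ζ grows at least linearly in both directions.
  have hmono : Monotone fun x => zeta p x - m * x := by
    refine monotone_of_hasDerivAt_nonneg (f' := fun x => p x ^ (-(1 / 2) : ℝ) - m * 1)
      (fun x => (hasDerivAt_zeta hp hpos x).sub ((hasDerivAt_id x).const_mul m)) fun x => ?_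
    have := Real.rpow_le_rpow_of_nonpos (hpos x) (hC x) (by norm_num : (-(1 / 2) : ℝ) ≤ 0)
    simpa [m] using this
  have h0 : zeta p 0 = 0 := by simp [zeta]
  refine Continuous.surjective
    (continuous_iff_continuousAt.2 fun x => (hasDerivAt_zeta hp hpos x).continuousAt) ?_ ?_
  · refine tendsto_atTop_mono' _ ?_ (tendsto_id.const_mul_atTop hm)
    filter_upwards [eventually_ge_atTop 0] with x hx
    have := hmono hx
    simp only [h0] at this
    simp only [id]
    linarith
  · refine tendsto_atBot_mono' _ ?_ (tendsto_id.const_mul_atBot hm)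
    filter_upwards [eventually_le_atBot 0] with x hx
    have := hmono hx
    simp only [h0] at this
    simp only [id]
    linarith

end Kernel

end VariableBandwidth

end

/-! ### The main theorem -/

open VariableBandwidth
theorem mainTheorem7 (p : ℝ → ℝ) (hp : LocAC p) (hp' : LocAC (deriv p)) (hpos : ∀ x, 0 < p x)
    (Λ : Set ℝ) (hΛ : MeasurableSet Λ) :
    (Function.Surjective (zeta p) →
      liouville p '' PW Λ (opA p) = PW Λ (opB (potential p)) ∧
      (∀ X : Set ℝ,
        upperDensity (muP p) X = upperDensity volume (zeta p '' X) ∧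
        lowerDensity (muP p) X = lowerDensity volume (zeta p '' X)) ∧
      (∀ k h : ℝ → L2,
        IsReproducingKernel (PW Λ (opA p)) k →
        IsReproducingKernel (PW Λ (opB (potential p))) h →
        ∀ x : ℝ, h (zeta p x) = ((p x ^ (1 / 4 : ℝ) : ℝ) : ℂ) • liouville p (k x))) ∧
    (∀ c C : ℝ, 0 < c → (∀ x, c ≤ p x ∧ p x ≤ C) →
      ∀ k h : ℝ → L2,
        IsReproducingKernel (PW Λ (opA p)) k →
        IsReproducingKernel (PW Λ (opB (potential p))) h →
        ∀ X : Set ℝ,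
          (IsFrame (PW Λ (opA p)) (fun x : X => k x) ↔
            IsFrame (PW Λ (opB (potential p))) (fun x : X => h (zeta p x))) ∧
          (IsRieszSequence (PW Λ (opA p)) (fun x : X => k x) ↔
            IsRieszSequence (PW Λ (opB (potential p))) (fun x : X => h (zeta p x)))) := by
  have hpc := hp.continuous
  refine ⟨fun hζ => ⟨liouville_image_PW hp hp' hpos hζ Λ, fun X =>
    ⟨upperDensity_muP hpc hpos hζ X, lowerDensity_muP hpc hpos hζ X⟩, fun k h hk hh x =>
    reproducingKernel_liouville hp hp' hpos hζ hk hh x⟩, fun c C hc hcC k h hk hh X => ?_⟩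
  have hζ := surjective_zeta_of_le hpc hpos fun x => (hcC x).2
  set U := liouvilleEquiv hpc hpos hζ
  have hPW : U '' PW Λ (opA p) = PW Λ (opB (potential p)) := liouville_image_PW hp hp' hpos hζ Λ
  have hPW' : U.symm '' PW Λ (opB (potential p)) = PW Λ (opA p) := by
    rw [← hPW, image_image]
    simp
  have hkh (x : X) : h (zeta p x) = ((p x ^ (1 / 4 : ℝ) : ℝ) : ℂ) • U (k x) :=
    reproducingKernel_liouville hp hp' hpos hζ hk hh x
  -- The inverse relation has the same form, with weights p^{-1/4} that are also bounded above and
  -- below; it yields the converse implications.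
  have hhk (x : X) : k x = (((p x ^ (1 / 4 : ℝ))⁻¹ : ℝ) : ℂ) • U.symm (h (zeta p x)) := by
    have hr : ((p x ^ (1 / 4 : ℝ) : ℝ) : ℂ) ≠ 0 :=
      Complex.ofReal_ne_zero.2 (Real.rpow_pos_of_pos (hpos x) _).ne'
    rw [hkh, U.symm.map_smul, U.symm_apply_apply, smul_smul, Complex.ofReal_inv,
      inv_mul_cancel₀ hr, one_smul]
  have hcr : 0 < c ^ (1 / 4 : ℝ) := Real.rpow_pos_of_pos hc _
  have hr (x : X) : c ^ (1 / 4 : ℝ) ≤ p x ^ (1 / 4 : ℝ) ∧ p x ^ (1 / 4 : ℝ) ≤ C ^ (1 / 4 : ℝ) :=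
    ⟨Real.rpow_le_rpow hc.le (hcC x).1 (by norm_num),
      Real.rpow_le_rpow (hpos x).le (hcC x).2 (by norm_num)⟩
  have hri (x : X) : (C ^ (1 / 4 : ℝ))⁻¹ ≤ (p x ^ (1 / 4 : ℝ))⁻¹ ∧
      (p x ^ (1 / 4 : ℝ))⁻¹ ≤ (c ^ (1 / 4 : ℝ))⁻¹ :=
    ⟨inv_anti₀ (hcr.trans_le (hr x).1) (hr x).2, inv_anti₀ hcr (hr x).1⟩
  have hCr : 0 < (C ^ (1 / 4 : ℝ))⁻¹ :=
    inv_pos.2 (Real.rpow_pos_of_pos (hc.trans_le ((hcC 0).1.trans (hcC 0).2)) _)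
  have hkV (x : X) : k x ∈ U.symm '' PW Λ (opB (potential p)) := hPW' ▸ hk.1 x
  have hhV (x : X) : h (zeta p x) ∈ U '' PW Λ (opA p) := hPW ▸ hh.1 _
  refine ⟨⟨fun H => ?_, fun H => ?_⟩, ⟨fun H => ?_, fun H => ?_⟩⟩
  · exact hPW ▸ H.map U hcr hr hkh hhV
  · exact hPW' ▸ H.map U.symm hCr hri hhk hkV
  · exact hPW ▸ H.map U hcr hr hkh hhV
  · exact hPW' ▸ H.map U.symm hCr hri hhk hkV
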